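/- \textbf{Theorem (Gibbs representation theorem, Kozlov).} Let $S$ be a countable set of sites and $E$ a finite non-empty set with its discrete $\sigma$-algebra and the normalized counting measure $\rho_0$. Let $\Omega=E^S$ with the product $\sigma$-algebra $\mathcal F$ and the a priori measure $\rho=\rho_0^{\otimes S}$. Write $\mathcal S$ for the set of finite subsets of $S$ and, for $\Delta\subseteq S$, $\mathcal F_\Delta$ for the $\sigma$-algebra generated by the spins in $\Delta$. A function $\Omega\to\mathbb R$ is \emph{local} if it is $\mathcal F_\Lambda$-measurable for some $\Lambda\in\mathcal S$, and \emph{quasilocal} if it is a uniform limit of local functions. A \emph{specification} is a family $\gamma=(\gamma_\Lambda)_{\Lambda\in\mathcal S}$ of probability kernels from $(\Omega,\mathcal F)$ to itself such that $\gamma_\Lambda(A\mid\cdot)$ is $\mathcal F_{\Lambda^c}$-measurable for all $A\in\mathcal F$; $\gamma_\Lambda(B\mid\omega)=\mathbf 1_B(\omega)$ for all $B\in\mathcal F_{\Lambda^c}$ and $\omega\in\Omega$; and $\gamma_\Lambda\gamma_{\Lambda'}=\gamma_\Lambda$ whenever $\Lambda'\subseteq\Lambda\in\mathcal S$. Let $\mathcal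 G(\gamma)$ be the set of probability measures $\mu$ on $(\Omega,\mathcal F)$ with $\mu[A\mid\mathcal F_{\Lambda^c}]=\gamma_\Lambda(A\mid\cdot)$ $\mu$-a.s. for all $\Lambda\in\mathcal S$ and $A\in\mathcal F$. The specification $\gamma$ is \emph{quasilocal} if $\omega\mapsto\int f\,d\gamma_\Lambda(\cdot\mid\omega)$ is quasilocal for all $\Lambda\in\mathcal S$ and all local $f$. It is \emph{uniformly non-null} if for every $\Lambda\in\mathcal S$ there are $0<\alpha_\Lambda\le\beta_\Lambda<\infty$ with $$\alpha_\Lambda\,\rho(A)\le\gamma_\Lambda(A\mid\omega)\le\beta_\Lambda\,\rho(A)\qquad\text{for all }\omega\in\Omega,\ A\in\mathcal F_\Lambda .$$ A probability measure is \emph{quasilocal} (resp. \emph{uniformly non-null}) if it belongs to $\mathcal G(\gamma)$ for some quasilocal (resp. uniformly non-null) specification $\gamma$. A \emph{potential} is a family $\Psi=(\Psi_A)_{A\in\mathcal S}$ of functions $\Psi_A:\Omega\to\mathbb R$ with $\Psi_A$ $\mathcal F_A$-measurable. It is \emph{uniformly absolutely convergent (UAC)} if $\sum_{A\in\mathcal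 S,\,A\ni i}\sup_{\omega}|\Psi_A(\omega)|<\infty$ for every $i\in S$. For a UAC potential put $H_\Lambda^\Psi=\sum_{A\in\mathcal S,\,A\cap\Lambda\neq\emptyset}\Psi_A$ and $$\gamma_\Lambda^\Psi(A\mid\omega)=\frac{1}{Z_\Lambda^\Psi(\omega)}\int_{A}e^{-H_\Lambda^\Psi}\,d\kappa_\Lambda^\omega ,\qquad Z_\Lambda^\Psi(\omega)=\int_\Omega e^{-H_\Lambda^\Psi}\,d\kappa_\Lambda^\omega ,$$ where $\kappa_\Lambda^\omega=\rho_0^{\otimes\Lambda}\otimes\delta_{\omega_{\Lambda^c}}$ (the inverse temperature is absorbed in the potential). \textbf{Statement.} Let $\mu$ be a quasilocal and uniformly non-null probability measure on $(\Omega,\mathcal F)$. Then $\mu$ is a Gibbs measure for a UAC potential: there is a UAC potential $\Psi$ such that $\gamma^\Psi=(\gamma_\Lambda^\Psi)_{\Lambda\in\mathcal S}$ is a specification and $\mu\in\mathcal G(\gamma^\Psi)$. -/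

import Mathlib

open MeasureTheory ProbabilityTheory
open scoped ENNReal

namespace GibbsRep

/-- A configuration assigns to each site of the lattice `S` a spin in `E`. -/
abbrev Config (S E : Type*) : Type _ := S → E

/-- The σ-algebra `𝓕_Δ` on the configuration space generated by the spins in `Δ ⊆ S`. -/
abbrev sigmaAlg {S : Type*} (E : Type*) [MeasurableSpace E] (Δ : Set S) :
    MeasurableSpace (Config S E) :=
  cylinderEvents (X := fun _ : S => E) Δ

/-- The a priori single-spin measure `ρ₀`: the normalized counting measure on `E`. -/
noncomputable def spinMeasure (E : Type*) [MeasurableSpace E] : Measure E :=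
  uniformOn Set.univ

/-- The a priori measure `ρ = ρ₀^{⊗ S}` on configurations. -/
noncomputable def aprioriMeasure (S E : Type*) [MeasurableSpace E] : Measure (Config S E) :=
  Measure.infinitePi fun _ : S => spinMeasure E

/-- The concatenated configuration `σ_Λ ω_{Λᶜ}`. -/
noncomputable def juxtapose {S E : Type*} (Λ : Finset S) (σ : Λ → E) (ω : Config S E) :
    Config S E :=
  open Classical in fun i => if h : i ∈ Λ then σ ⟨i, h⟩ else ω i

/-- A function is local if it is measurable with respect to finitely many spins. -/
def IsLocal {S E : Type*} [MeasurableSpace E] (f : Config S E → ℝ) : Prop :=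
  ∃ Λ : Finset S, Measurable[sigmaAlg E (Λ : Set S)] f

/-- A function is quasilocal if it is a uniform limit of local functions. -/
def IsQuasilocalFun {S E : Type*} [MeasurableSpace E] (f : Config S E → ℝ) : Prop :=
  ∀ ε : ℝ, 0 < ε → ∃ g : Config S E → ℝ, IsLocal g ∧ ∀ ω, |f ω - g ω| < ε

/-- A specification: a consistent family of proper probability kernels `γ_Λ`,
one for each finite `Λ ⊆ S`, such that `γ_Λ(A | ·)` depends only on the spins outside `Λ`. -/
structure Specification (S E : Type*) [MeasurableSpace E] where
  kernel : Finset S → Kernel (Config S E) (Config S E)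
  isMarkov : ∀ Λ, IsMarkovKernel (kernel Λ)
  measurable_compl : ∀ (Λ : Finset S) (A : Set (Config S E)), MeasurableSet A →
    Measurable[sigmaAlg E ((Λ : Set S)ᶜ)] fun ω => kernel Λ ω A
  proper : ∀ (Λ : Finset S) (ω : Config S E) (B : Set (Config S E)),
    MeasurableSet[sigmaAlg E ((Λ : Set S)ᶜ)] B → kernel Λ ω B = B.indicator 1 ω
  consistent : ∀ Λ' Λ : Finset S, Λ' ⊆ Λ → kernel Λ' ∘ₖ kernel Λ = kernel Λ

/-- `μ ∈ 𝒢(γ)`: `μ` is a probability measure and, for every finite `Λ`, the kernel `γ_Λ` is a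
version of the conditional probability of `μ` given the spins outside `Λ`. -/
def IsDLR {S E : Type*} [MeasurableSpace E] (γ : Specification S E)
    (μ : Measure (Config S E)) : Prop :=
  IsProbabilityMeasure μ ∧
    ∀ (Λ : Finset S) (A : Set (Config S E)), MeasurableSet A →
      μ[A.indicator (fun _ => (1 : ℝ)) | sigmaAlg E ((Λ : Set S)ᶜ)]
        =ᵐ[μ] fun ω => (γ.kernel Λ ω).real A

/-- A specification is quasilocal if `γ_Λ f` is quasilocal for all finite `Λ` and local `f`. -/
def Specification.IsQuasilocal {S E : Type*} [MeasurableSpace E]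
    (γ : Specification S E) : Prop :=
  ∀ (Λ : Finset S) (f : Config S E → ℝ), IsLocal f →
    IsQuasilocalFun fun ω => ∫ σ, f σ ∂(γ.kernel Λ ω)

/-- Uniform non-nullness: for each finite `Λ`, on the events depending only on the spins in `Λ`,
`γ_Λ(· | ω)` is comparable with the a priori measure, uniformly in `ω`. -/
def Specification.IsUniformlyNonNull {S E : Type*} [MeasurableSpace E]
    (γ : Specification S E) : Prop :=
  ∀ Λ : Finset S, ∃ α β : ℝ, 0 < α ∧ α ≤ β ∧
    ∀ (ω : Config S E) (A : Set (Config S E)), MeasurableSet[sigmaAlg E (Λ : Set S)] A →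
      α * (aprioriMeasure S E).real A ≤ (γ.kernel Λ ω).real A ∧
      (γ.kernel Λ ω).real A ≤ β * (aprioriMeasure S E).real A

/-- A measure is quasilocal if it is specified by some quasilocal specification. -/
def IsQuasilocalMeasure {S E : Type*} [MeasurableSpace E] (μ : Measure (Config S E)) : Prop :=
  ∃ γ : Specification S E, γ.IsQuasilocal ∧ IsDLR γ μ

/-- A measure is uniformly non-null if it is specified by some uniformly non-null
specification. -/
def IsUniformlyNonNullMeasure {S E : Type*} [MeasurableSpace E]
    (μ : Measure (Config S E)) : Prop :=
  ∃ γ : Specification S E, γ.IsUniformlyNonNull ∧ IsDLR γ μ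

/-- A potential: a family of functions `Φ_A`, indexed by the finite `A ⊆ S`, such that `Φ_A`
depends only on the spins in `A`. -/
structure Potential (S E : Type*) [MeasurableSpace E] where
  toFun : Finset S → Config S E → ℝ
  measurable_toFun : ∀ A : Finset S, Measurable[sigmaAlg E (A : Set S)] (toFun A)

/-- Uniform absolute convergence: `∑_{A ∋ i} sup_ω |Φ_A(ω)| < ∞` for every site `i`. -/
def Potential.IsUAC {S E : Type*} [MeasurableSpace E] (Φ : Potential S E) : Prop :=
  ∀ i : S, ∑' A : {A : Finset S // i ∈ A}, ⨆ ω : Config S E, ENNReal.ofReal |Φ.toFun A ω| < ∞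

/-- The Hamiltonian `H_Λ(ω) = ∑_{A ∩ Λ ≠ ∅} Φ_A(ω)`
(an absolutely convergent series when `Φ` is UAC). -/
noncomputable def Potential.hamiltonian {S E : Type*} [MeasurableSpace E] (Φ : Potential S E)
    (Λ : Finset S) (ω : Config S E) : ℝ :=
  ∑' A : {A : Finset S // ∃ i ∈ A, i ∈ Λ}, Φ.toFun A ω

/-- The measure `κ_Λ^ω = ρ_Λ ⊗ δ_{ω_{Λᶜ}}`: the spins in `Λ` follow the a priori measure, and those
outside `Λ` are frozen to `ω`. -/
noncomputable def boundaryMeasure {S E : Type*} [MeasurableSpace E]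
    (Λ : Finset S) (ω : Config S E) : Measure (Config S E) :=
  (Measure.pi fun _ : Λ => spinMeasure E).map fun σ => juxtapose Λ σ ω

/-- The partition function `Z_Λ(ω) = ∫ exp(-H_Λ) dκ_Λ^ω`. -/
noncomputable def Potential.partitionFunction {S E : Type*} [MeasurableSpace E]
    (Φ : Potential S E) (Λ : Finset S) (ω : Config S E) : ℝ :=
  ∫ σ, Real.exp (-Φ.hamiltonian Λ σ) ∂(boundaryMeasure Λ ω)

/-- The Gibbs distribution in `Λ` with boundary condition `ω`:
`γ_Λ^Φ(A | ω) = Z_Λ(ω)⁻¹ ∫_A exp(-H_Λ) dκ_Λ^ω`. -/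
noncomputable def Potential.gibbsDistribution {S E : Type*} [MeasurableSpace E]
    (Φ : Potential S E) (Λ : Finset S) (ω : Config S E) : Measure (Config S E) :=
  (boundaryMeasure Λ ω).withDensity fun σ =>
    ENNReal.ofReal (Real.exp (-Φ.hamiltonian Λ σ) / Φ.partitionFunction Λ ω)

/-- `μ ∈ 𝒢(γ^Φ)`: the Gibbs distributions of `Φ` are the kernels of a specification `γ^Φ`, and
`μ` is a DLR measure for it. -/
def Potential.IsGibbsMeasure {S E : Type*} [MeasurableSpace E] (Φ : Potential S E)
    (μ : Measure (Config S E)) : Prop :=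
  ∃ γ : Specification S E, (∀ Λ ω, γ.kernel Λ ω = Φ.gibbsDistribution Λ ω) ∧ IsDLR γ μ

end GibbsRep

namespace GibbsRep

open Filter Topology

/-! ### Configurations and measurability with respect to a set of spins -/

section Measurability

variable {S E : Type*}

/-! Let `γ` be a quasilocal specification for `μ`. Uniform non-nullness bounds the cylinder
probabilities of another specification for `μ`. Both are versions of the same conditional
probabilities, and `μ` charges every cylinder, so continuity carries the bound to `γ` at every
boundary condition (`exists_pos_le_weight`). Hence the weights of `γ` have logarithms of vanishing
oscillation.

By consistency, log-ratios of weights do not depend on the volume (`log_weight_sub_log_weight`).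
Number the sites and fix a reference configuration `a`. The energy of a configuration telescopes
into costs `D k` of changing site `k` to `a` when all earlier sites already equal `a`. Such a cost
ignores the earlier sites and expands into a normally convergent series of local functions supported
away from them (`exists_hasSum`). Therefore only finitely many of these series involve a given site.
Collecting the terms by support gives a UAC potential whose energy differences are the log-ratios of
the weights, so its Gibbs distributions are the kernels of `γ` itself. -/

/-- The configuration equal to `ω` on `Λ` and to `η` off `Λ`. -/
noncomputable def glue (Λ : Finset S) (ω η : Config S E) : Config S E :=
  juxtapose Λ (fun i => ω i) η

lemma juxtapose_of_mem {Λ : Finset S} (σ : Λ → E) (ω : Config S E) {i : S} (h : i ∈ Λ) :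
    juxtapose Λ σ ω i = σ ⟨i, h⟩ := by
  simp [juxtapose, h]

lemma juxtapose_of_notMem {Λ : Finset S} (σ : Λ → E) (ω : Config S E) {i : S} (h : i ∉ Λ) :
    juxtapose Λ σ ω i = ω i := by
  simp [juxtapose, h]

lemma glue_of_mem {Λ : Finset S} (ω η : Config S E) {i : S} (h : i ∈ Λ) :
    glue Λ ω η i = ω i := juxtapose_of_mem _ _ h

lemma glue_of_notMem {Λ : Finset S} (ω η : Config S E) {i : S} (h : i ∉ Λ) :
    glue Λ ω η i = η i := juxtapose_of_notMem _ _ h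

lemma glue_glue_of_subset {Λ Λ' : Finset S} (h : Λ ⊆ Λ') (a ω : Config S E) :
    glue Λ' a (glue Λ a ω) = glue Λ' a ω := by
  ext i
  by_cases hi : i ∈ Λ'
  · rw [glue_of_mem _ _ hi, glue_of_mem _ _ hi]
  · rw [glue_of_notMem _ _ hi, glue_of_notMem _ _ hi, glue_of_notMem _ _ fun h' => hi (h h')]

lemma glue_self_glue (Λ : Finset S) (a ω : Config S E) :
    glue Λ a (glue Λ a ω) = glue Λ a ω := glue_glue_of_subset subset_rfl a ω

lemma juxtapose_injective (Λ : Finset S) (ω : Config S E) :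
    Function.Injective fun σ : Λ → E => juxtapose Λ σ ω := by
  intro σ τ h
  ext i
  have := congrFun h i
  simpa [juxtapose_of_mem _ _ i.2] using this

lemma mem_range_juxtapose_iff {Λ : Finset S} {ω η : Config S E} :
    η ∈ Set.range (fun σ : Λ → E => juxtapose Λ σ ω) ↔ ∀ i ∉ Λ, η i = ω i := by
  constructor
  · rintro ⟨σ, rfl⟩ i hi
    exact juxtapose_of_notMem _ _ hi
  · intro h
    refine ⟨fun i => η i, funext fun i => ?_⟩
    by_cases hi : i ∈ Λ
    · exact juxtapose_of_mem _ _ hi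
    · exact (juxtapose_of_notMem _ _ hi).trans (h i hi).symm

variable [MeasurableSpace E]

/-- The generators of `sigmaAlg E Δ` factor through restriction to `Δ`, so each of its events is a
preimage under that restriction. -/
lemma mem_iff_of_measurableSet_sigmaAlg {Δ : Set S} {B : Set (Config S E)}
    (hB : MeasurableSet[sigmaAlg E Δ] B) {ω η : Config S E} (h : ∀ i ∈ Δ, ω i = η i) :
    ω ∈ B ↔ η ∈ B := by
  let m : MeasurableSpace (Config S E) := MeasurableSpace.pi.comap Δ.domRestrict
  have hm : sigmaAlg E Δ ≤ m := by
    refine iSup₂_le fun i hi => ?_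
    have : (fun σ : Config S E => σ i)
        = (fun τ : Δ → E => τ ⟨i, hi⟩) ∘ Δ.domRestrict := rfl
    rw [this, ← MeasurableSpace.comap_comp]
    exact MeasurableSpace.comap_mono (measurable_pi_apply _).comap_le
  obtain ⟨T, -, rfl⟩ := hm _ hB
  have : Δ.domRestrict ω = Δ.domRestrict η := funext fun i => h i i.2
  simp [this]

lemma dependsOn_of_measurable_sigmaAlg {β : Type*} [MeasurableSpace β]
    [MeasurableSingletonClass β] {Δ : Set S} {f : Config S E → β}
    (hf : Measurable[sigmaAlg E Δ] f) : DependsOn f Δ := by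
  intro ω η h
  have := mem_iff_of_measurableSet_sigmaAlg (hf (measurableSet_singleton (f η))) h
  simpa using this

/-- Restriction to the finite set `Λ` takes values in a finite discrete space, where every function
is measurable. -/
lemma measurable_sigmaAlg_of_dependsOn [Finite E] [DiscreteMeasurableSpace E]
    {β : Type*} [MeasurableSpace β] [Nonempty β] {Λ : Finset S} {f : Config S E → β}
    (hf : DependsOn f (Λ : Set S)) : Measurable[sigmaAlg E (Λ : Set S)] f := by
  obtain ⟨g, rfl⟩ := dependsOn_iff_exists_comp.1 hf
  have hg : Measurable g := by
    have : Finite ((i : (Λ : Set S)) → E) := Pi.finite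
    exact Measurable.of_discrete
  exact hg.comp (measurable_restrict_cylinderEvents (X := fun _ : S => E) (Λ : Set S))

lemma measurableSet_agree [Countable S] [MeasurableSingletonClass E] (Δ : Set S)
    (ω : Config S E) : MeasurableSet[sigmaAlg E Δ] {η | ∀ i ∈ Δ, η i = ω i} := by
  have : {η : Config S E | ∀ i ∈ Δ, η i = ω i}
      = ⋂ i ∈ Δ, (fun σ : Config S E => σ i) ⁻¹' {ω i} := by
    ext; simp
  rw [this]
  refine MeasurableSet.biInter (Set.to_countable _) fun i hi => ?_
  have hle : (inferInstance : MeasurableSpace E).comap (fun σ : Config S E => σ i)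
      ≤ sigmaAlg E Δ :=
    le_iSup₂ (f := fun (i : S) (_ : i ∈ Δ) =>
      (inferInstance : MeasurableSpace E).comap fun σ : Config S E => σ i) i hi
  exact hle _ ⟨_, measurableSet_singleton _, rfl⟩

end Measurability

/-! ### Quasilocality in terms of oscillations -/

section Oscillation

variable {S E : Type*}

/-- The oscillation of `f` over configurations agreeing on a finite set tends to zero. -/
def HasVanishingOscillation (f : Config S E → ℝ) : Prop :=
  ∀ ε : ℝ, 0 < ε → ∃ Λ : Finset S, ∀ ω η : Config S E,
    (∀ i ∈ Λ, ω i = η i) → |f ω - f η| ≤ ε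

lemma IsQuasilocalFun.hasVanishingOscillation [MeasurableSpace E] {f : Config S E → ℝ}
    (hf : IsQuasilocalFun f) : HasVanishingOscillation f := by
  intro ε hε
  obtain ⟨g, ⟨Λ, hg⟩, hfg⟩ := hf (ε / 2) (by positivity)
  refine ⟨Λ, fun ω η h => ?_⟩
  have hgg : g ω = g η := dependsOn_of_measurable_sigmaAlg hg h
  have h1 := abs_lt.1 (hfg ω)
  have h2 := abs_lt.1 (hfg η)
  rw [hgg] at h1
  exact abs_le.2 ⟨by linarith, by linarith⟩

namespace HasVanishingOscillation

lemma sub {f g : Config S E → ℝ} (hf : HasVanishingOscillation f)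
    (hg : HasVanishingOscillation g) : HasVanishingOscillation fun ω => f ω - g ω := by
  classical
  intro ε hε
  obtain ⟨Λ, hΛ⟩ := hf (ε / 2) (by positivity)
  obtain ⟨Λ', hΛ'⟩ := hg (ε / 2) (by positivity)
  refine ⟨Λ ∪ Λ', fun ω η h => ?_⟩
  have h1 := abs_le.1 (hΛ ω η fun i hi => h i (Finset.mem_union_left _ hi))
  have h2 := abs_le.1 (hΛ' ω η fun i hi => h i (Finset.mem_union_right _ hi))
  exact abs_le.2 ⟨by linarith, by linarith⟩

lemma comp_glue {f : Config S E → ℝ} (hf : HasVanishingOscillation f) (Λ : Finset S)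
    (a : Config S E) : HasVanishingOscillation fun ω => f (glue Λ a ω) := by
  intro ε hε
  obtain ⟨Λ', h'⟩ := hf ε hε
  refine ⟨Λ', fun ω η h => h' _ _ fun i hi => ?_⟩
  by_cases hi' : i ∈ Λ
  · simp [glue_of_mem _ _ hi']
  · simp [glue_of_notMem _ _ hi', h i hi]

/-- Since `log (s / t) ≤ s / t - 1`, an oscillation of at most `c * ε` suffices for a function
bounded below by `c`. -/
lemma log {f : Config S E → ℝ} (hf : HasVanishingOscillation f) {c : ℝ} (hc : 0 < c)
    (hcf : ∀ ω, c ≤ f ω) : HasVanishingOscillation fun ω => Real.log (f ω) := by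
  intro ε hε
  obtain ⟨Λ, h⟩ := hf (c * ε) (by positivity)
  have key : ∀ ω η, |f ω - f η| ≤ c * ε → Real.log (f ω) - Real.log (f η) ≤ ε := by
    intro ω η hωη
    have hω := hc.trans_le (hcf ω)
    have hη := hc.trans_le (hcf η)
    rw [← Real.log_div hω.ne' hη.ne']
    refine (Real.log_le_sub_one_of_pos (div_pos hω hη)).trans ?_
    rw [div_sub_one hη.ne', div_le_iff₀ hη]
    nlinarith [le_of_abs_le hωη, hcf η]
  refine ⟨Λ, fun ω η hωη => abs_le.2 ⟨?_, key _ _ (h _ _ hωη)⟩⟩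
  linarith [key η ω (h _ _ fun i hi => (hωη i hi).symm)]

/-- There are finitely many patterns on `Λ`, so one finite window serves them all; including `Λ` in
it fixes the pattern selected. -/
lemma select [Finite E] {Λ : Finset S} {G : (Λ → E) → Config S E → ℝ}
    (hG : ∀ τ, HasVanishingOscillation (G τ)) :
    HasVanishingOscillation fun ω : Config S E => G (fun i => ω i) ω := by
  classical
  have := Fintype.ofFinite E
  intro ε hε
  choose M hM using fun τ => hG τ ε hε
  refine ⟨Λ ∪ Finset.univ.biUnion M, fun ω η h => ?_⟩
  have : (fun i : Λ => ω i) = fun i : Λ => η i :=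
    funext fun i => h i (Finset.mem_union_left _ i.2)
  simp only [this]
  exact hM _ _ _ fun i hi =>
    h i (Finset.mem_union_right _ (Finset.mem_biUnion.2 ⟨_, Finset.mem_univ _, hi⟩))

/-- A function of vanishing oscillation is the sum of a normally convergent series of local
functions; sites on which it does not depend are not needed. -/
lemma exists_hasSum [Finite E] {f : Config S E → ℝ}
    (hf : HasVanishingOscillation f) (V : Finset S) (a : Config S E)
    (hV : ∀ ω, f (glue V a ω) = f ω) :
    ∃ (B : ℕ → Finset S) (ψ : ℕ → Config S E → ℝ) (c : ℕ → ℝ),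
      (∀ n, DependsOn (ψ n) (B n : Set S)) ∧ (∀ n, Disjoint (B n) V) ∧
      (∀ n ω, |ψ n ω| ≤ c n) ∧ Summable c ∧ ∀ ω, HasSum (fun n => ψ n ω) (f ω) := by
  classical
  choose M hM using fun n : ℕ => hf ((1 / 2) ^ n) (by positivity)
  -- Local approximations: freeze the spins to `a` off a finite window. The window may omit `V`,
  -- because `hV` allows the spins there to be overwritten by `a`.
  let g : ℕ → Config S E → ℝ := fun n ω => f (glue (M n \ V) ω a)
  have hgf : ∀ n ω, |g n ω - f ω| ≤ (1 / 2) ^ n := by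
    intro n ω
    have : g n ω = f (glue V a (glue (M n \ V) ω a)) := (hV _).symm
    rw [this, ← hV ω]
    refine hM n _ _ fun i hi => ?_
    by_cases hiV : i ∈ V
    · simp [glue_of_mem _ _ hiV]
    · rw [glue_of_notMem _ _ hiV, glue_of_notMem _ _ hiV, glue_of_mem]
      simp [hi, hiV]
  have hgdep : ∀ n, DependsOn (g n) ((M n \ V : Finset S) : Set S) := by
    intro n ω η h
    have : glue (M n \ V) ω a = glue (M n \ V) η a := by
      ext i
      by_cases hi : i ∈ M n \ V
      · rw [glue_of_mem _ _ hi, glue_of_mem _ _ hi]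
        exact h i hi
      · rw [glue_of_notMem _ _ hi, glue_of_notMem _ _ hi]
    simp only [g, this]
  obtain ⟨C, hC⟩ : ∃ C, ∀ ω, |g 0 ω| ≤ C := by
    obtain ⟨C, hC⟩ := (Set.finite_range fun σ : ↥(M 0 \ V) → E =>
      |f (juxtapose (M 0 \ V) σ a)|).bddAbove
    exact ⟨C, fun ω => hC ⟨fun i => ω i, rfl⟩⟩
  -- Term `0` is `g 0`, bounded because it takes finitely many values; term `n + 1` is the increment
  -- from `g n` to `g (n + 1)`.
  let B : ℕ → Finset S := fun n =>
    Nat.casesOn n (M 0 \ V) fun n => (M (n + 1) \ V) ∪ (M n \ V)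
  let ψ : ℕ → Config S E → ℝ := fun n =>
    Nat.casesOn n (g 0) fun n ω => g (n + 1) ω - g n ω
  let c : ℕ → ℝ := fun n => Nat.casesOn n C fun n => 2 * (1 / 2) ^ n
  have hc : Summable c := by
    rw [← summable_nat_add_iff 1]
    exact (summable_geometric_of_lt_one (by norm_num) (by norm_num : (1 / 2 : ℝ) < 1)).mul_left 2
  have hψc : ∀ n ω, |ψ n ω| ≤ c n := by
    rintro (_ | n) ω
    · exact hC ω
    · have h1 := abs_le.1 (hgf n ω)
      have h2 := abs_le.1 (hgf (n + 1) ω)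
      have h3 : (1 / 2 : ℝ) ^ (n + 1) ≤ (1 / 2) ^ n :=
        pow_le_pow_of_le_one (by norm_num) (by norm_num) n.le_succ
      show |g (n + 1) ω - g n ω| ≤ 2 * (1 / 2) ^ n
      exact abs_le.2 ⟨by linarith, by linarith⟩
  refine ⟨B, ψ, c, ?_, ?_, hψc, hc, fun ω => ?_⟩
  · rintro (_ | n)
    · exact hgdep 0
    · intro ω η h
      have h1 : g (n + 1) ω = g (n + 1) η :=
        hgdep _ fun i hi => h i (Finset.mem_coe.2 (Finset.mem_union_left _ hi))
      have h2 : g n ω = g n η :=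
        hgdep _ fun i hi => h i (Finset.mem_coe.2 (Finset.mem_union_right _ hi))
      simp only [ψ, h1, h2]
  · rintro (_ | n)
    · exact Finset.sdiff_disjoint
    · exact Finset.disjoint_union_left.2 ⟨Finset.sdiff_disjoint, Finset.sdiff_disjoint⟩
  · rw [(Summable.of_norm_bounded hc fun n => hψc n ω).hasSum_iff_tendsto_nat,
      ← tendsto_add_atTop_iff_nat 1]
    have hsum : ∀ n, ∑ k ∈ Finset.range (n + 1), ψ k ω = g n ω := by
      intro n
      induction n with
      | zero => simp [ψ]
      | succ n ih => rw [Finset.sum_range_succ, ih]; simp [ψ]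
    simp only [hsum]
    rw [tendsto_iff_dist_tendsto_zero]
    exact squeeze_zero (fun _ => dist_nonneg) (fun n => hgf n ω)
      (tendsto_pow_atTop_nhds_zero_of_lt_one (by norm_num) (by norm_num))

end HasVanishingOscillation

end Oscillation

/-! ### Potentials assembled from a family of local functions -/

section Assemble

variable {S E ι : Type*} [MeasurableSpace E]

/-- A family of local functions whose majorants are summable along the members seeing any given
site can be collected to a uniformly absolutely convergent potential. -/
lemma exists_potential_isUAC [Finite E] [Nonempty E] [DiscreteMeasurableSpace E]
    {B : ι → Finset S} {ψ : ι → Config S E → ℝ} {c : ι → ℝ}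
    (hdep : ∀ p, DependsOn (ψ p) (B p : Set S)) (hψc : ∀ p ω, |ψ p ω| ≤ c p)
    (hc : ∀ j, Summable ({p | j ∈ B p}.indicator c)) :
    ∃ Ψ : Potential S E, Ψ.IsUAC ∧ ∀ (Λ : Finset S) (ω : Config S E),
      HasSum ({p | ∃ i ∈ B p, i ∈ Λ}.indicator fun p => ψ p ω) (Ψ.hamiltonian Λ ω) := by
  have hc0 : ∀ p, 0 ≤ c p := fun p =>
    (abs_nonneg _).trans (hψc p (Classical.arbitrary (Config S E)))
  -- The interaction on `A` collects the members indexed with support exactly `A`.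
  let Φ : Finset S → Config S E → ℝ := fun A ω => ∑' b : B ⁻¹' {A}, ψ b ω
  have hΦ : ∀ A : Finset S, DependsOn (Φ A) (A : Set S) := by
    intro A ω η h
    refine tsum_congr fun b => hdep b fun i hi => h i ?_
    have hb : B b = A := b.2
    rwa [hb] at hi
  refine ⟨⟨Φ, fun A => measurable_sigmaAlg_of_dependsOn (hΦ A)⟩, fun j => ?_, fun Λ ω => ?_⟩
  · let d : ι → ℝ≥0∞ := fun p => ENNReal.ofReal ({p | j ∈ B p}.indicator c p)
    have hbound : ∀ A : {A : Finset S // j ∈ A},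
        ⨆ ω, ENNReal.ofReal |Φ A ω| ≤ ∑' b : B ⁻¹' {(A : Finset S)}, d b := by
      intro A
      refine iSup_le fun ω => ?_
      rw [← Real.norm_eq_abs, ofReal_norm]
      refine enorm_tsum_le_tsum_enorm.trans (ENNReal.tsum_le_tsum fun b => ?_)
      have hb : j ∈ B b := by
        have : B b = A := b.2
        rw [this]; exact A.2
      rw [← ofReal_norm, Real.norm_eq_abs]
      simp only [d]
      rw [Set.indicator_of_mem (show (b : ι) ∈ {p | j ∈ B p} from hb)]
      exact ENNReal.ofReal_le_ofReal (hψc b ω)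
    calc ∑' A : {A : Finset S // j ∈ A}, ⨆ ω, ENNReal.ofReal |Φ A ω|
        ≤ ∑' A : {A : Finset S // j ∈ A}, ∑' b : B ⁻¹' {(A : Finset S)}, d b :=
          ENNReal.tsum_le_tsum hbound
      _ ≤ ∑' A : Finset S, ∑' b : B ⁻¹' {A}, d b :=
          ENNReal.tsum_comp_le_tsum_of_injective Subtype.val_injective
            fun A : Finset S => ∑' b : B ⁻¹' {A}, d b
      _ = ∑' p, d p := ENNReal.tsum_fiberwise d B
      _ < ∞ := (hc j).tsum_ofReal_lt_top
  · classical
    let f : ι → ℝ := {p | ∃ i ∈ B p, i ∈ Λ}.indicator fun p => ψ p ω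
    have hf : Summable f := by
      refine Summable.of_norm_bounded (summable_sum fun j (_ : j ∈ Λ) => hc j) fun p => ?_
      have hnn : ∀ j ∈ Λ, 0 ≤ {p | j ∈ B p}.indicator c p :=
        fun j _ => Set.indicator_nonneg (fun p _ => hc0 p) p
      by_cases hp : p ∈ {p | ∃ i ∈ B p, i ∈ Λ}
      · simp only [f]
        rw [Set.indicator_of_mem hp, Real.norm_eq_abs]
        obtain ⟨i, hi, hiΛ⟩ := hp
        refine (hψc p ω).trans ?_
        have := Finset.single_le_sum hnn hiΛ
        rwa [Set.indicator_of_mem (show p ∈ {p | i ∈ B p} from hi)] at this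
      · simp only [f]
        rw [Set.indicator_of_notMem hp, norm_zero]
        exact Finset.sum_nonneg hnn
    have hfib := hf.hasSum.tsum_fiberwise B
    suffices h : Potential.hamiltonian ⟨Φ, fun A => measurable_sigmaAlg_of_dependsOn (hΦ A)⟩ Λ ω
        = ∑' p, f p by
      rw [h]; exact hf.hasSum
    rw [← hfib.tsum_eq]
    -- Meeting `Λ` is constant on the fibres of `B`, so the series over `p` regroups by support.
    refine (tsum_subtype {A : Finset S | ∃ i ∈ A, i ∈ Λ} fun A => Φ A ω).trans ?_
    refine tsum_congr fun A => ?_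
    by_cases hA : A ∈ {A : Finset S | ∃ i ∈ A, i ∈ Λ}
    · rw [Set.indicator_of_mem hA]
      refine tsum_congr fun b => ?_
      have hb : B b = A := b.2
      refine (Set.indicator_of_mem (s := {p | ∃ i ∈ B p, i ∈ Λ}) ?_ fun p => ψ p ω).symm
      rw [← hb] at hA
      exact hA
    · rw [Set.indicator_of_notMem hA]
      refine Eq.symm ?_
      rw [← tsum_zero (β := B ⁻¹' {A})]
      refine tsum_congr fun b => Set.indicator_of_notMem ?_ _
      have hb : B b = A := b.2
      rw [← hb] at hA
      exact hA

end Assemble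

/-! ### Weights of a specification -/

section Spec

variable {S E : Type*} [MeasurableSpace E]

namespace Specification

variable (γ : Specification S E)

/-- The conditional probability of the configuration inside `Λ` given the one outside `Λ`. -/
noncomputable def weight (Λ : Finset S) (ω : Config S E) : ℝ :=
  (γ.kernel Λ ω).real {ω}

lemma kernel_congr {Λ : Finset S} {ω η : Config S E} (h : ∀ i ∉ Λ, ω i = η i) :
    γ.kernel Λ ω = γ.kernel Λ η :=
  Measure.ext fun A hA =>
    dependsOn_of_measurable_sigmaAlg (γ.measurable_compl Λ A hA) fun i hi => h i hi

variable [Countable S]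

section

variable [MeasurableSingletonClass E]

lemma kernel_compl_agree {Λ : Finset S} (ω : Config S E) :
    γ.kernel Λ ω {η | ∀ i ∉ Λ, η i = ω i}ᶜ = 0 := by
  have h := measurableSet_agree ((Λ : Set S)ᶜ) ω
  have h0 := γ.proper Λ ω _ (MeasurableSet.compl (m := sigmaAlg E ((Λ : Set S)ᶜ)) h)
  rw [Set.indicator_of_notMem (by simp)] at h0
  exact h0

lemma kernel_inter_agree {Λ : Finset S} (ω : Config S E) (A : Set (Config S E)) :
    γ.kernel Λ ω (A ∩ {η | ∀ i ∉ Λ, η i = ω i}) = γ.kernel Λ ω A :=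
  measure_inter_conull (γ.kernel_compl_agree ω)

/-- Off `Λ` the kernel is frozen to `ω`. Unlike `{ω}`, the cylinder lies in `𝓕_Λ`, where
quasilocality and non-nullness apply. -/
lemma real_cylinder_eq_weight (Λ : Finset S) (ω : Config S E) :
    (γ.kernel Λ ω).real {σ | ∀ i : Λ, σ i = ω i} = γ.weight Λ ω := by
  have : {σ : Config S E | ∀ i : Λ, σ i = ω i} ∩ {η | ∀ i ∉ Λ, η i = ω i} = {ω} := by
    ext σ
    simp only [Set.mem_inter_iff, Set.mem_ofPred_eq, Set.mem_singleton_iff]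
    constructor
    · rintro ⟨h1, h2⟩
      ext i
      by_cases hi : i ∈ Λ
      · exact h1 ⟨i, hi⟩
      · exact h2 i hi
    · rintro rfl
      simp
  rw [weight, measureReal_def, measureReal_def, ← γ.kernel_inter_agree ω, this]

/-- By consistency the left side averages `γ.kernel Λ' η {ω}` over `η`. This integrand is `γ.weight
Λ' ω` if `η` agrees with `ω` off `Λ'`, and zero otherwise. -/
lemma weight_eq_mul {Λ' Λ : Finset S} (h : Λ' ⊆ Λ) (ω : Config S E) :
    γ.weight Λ ω =
      γ.weight Λ' ω * (γ.kernel Λ ω).real {η | ∀ i ∉ Λ', η i = ω i} := by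
  have hB : MeasurableSet {η : Config S E | ∀ i ∉ Λ', η i = ω i} :=
    cylinderEvents_le_pi _ (measurableSet_agree ((Λ' : Set S)ᶜ) ω)
  have key : γ.kernel Λ ω {ω} =
      γ.kernel Λ' ω {ω} * γ.kernel Λ ω {η | ∀ i ∉ Λ', η i = ω i} := by
    conv_lhs => rw [← γ.consistent Λ' Λ h]
    rw [Kernel.comp_apply' _ _ _ (measurableSet_singleton ω), ← lintegral_indicator_const hB]
    refine lintegral_congr fun η => ?_
    by_cases hη : η ∈ {η : Config S E | ∀ i ∉ Λ', η i = ω i}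
    · rw [Set.indicator_of_mem hη, γ.kernel_congr hη]
    · rw [Set.indicator_of_notMem hη]
      refine measure_mono_null ?_ (γ.kernel_compl_agree η)
      rintro _ rfl hω
      exact hη fun i hi => (hω i hi).symm
  simp only [weight, measureReal_def, key, ENNReal.toReal_mul]

/-- The second factor in `weight_eq_mul` is the same for `ω` and `η`. -/
lemma weight_mul_weight_comm {Λ' Λ : Finset S} (h : Λ' ⊆ Λ) {ω η : Config S E}
    (hωη : ∀ i ∉ Λ', ω i = η i) :
    γ.weight Λ ω * γ.weight Λ' η = γ.weight Λ η * γ.weight Λ' ω := by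
  have hk : γ.kernel Λ ω = γ.kernel Λ η :=
    γ.kernel_congr fun i hi => hωη i fun hi' => hi (h hi')
  have hB : {σ : Config S E | ∀ i ∉ Λ', σ i = ω i} = {σ | ∀ i ∉ Λ', σ i = η i} := by
    ext σ
    exact forall₂_congr fun i hi => by rw [hωη i hi]
  rw [γ.weight_eq_mul h ω, γ.weight_eq_mul h η, hk, hB]
  ring

lemma log_weight_sub_log_weight (hpos : ∀ Λ ω, 0 < γ.weight Λ ω) {Λ' Λ : Finset S}
    (h : Λ' ⊆ Λ) {ω η : Config S E} (hωη : ∀ i ∉ Λ', ω i = η i) :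
    Real.log (γ.weight Λ ω) - Real.log (γ.weight Λ η)
      = Real.log (γ.weight Λ' ω) - Real.log (γ.weight Λ' η) := by
  have := congrArg Real.log (γ.weight_mul_weight_comm h hωη)
  rw [Real.log_mul (hpos _ _).ne' (hpos _ _).ne', Real.log_mul (hpos _ _).ne' (hpos _ _).ne']
    at this
  linarith

end

/-- Two measures that live on the configurations agreeing with `ω` off `Λ` and give the same mass
to each of them are equal. -/
lemma _root_.GibbsRep.measure_eq_of_range_juxtapose [Finite E] [MeasurableSingletonClass E]
    {Λ : Finset S} {ω : Config S E} {μ ν : Measure (Config S E)}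
    (hμ : μ (Set.range fun σ : Λ → E => juxtapose Λ σ ω)ᶜ = 0)
    (hν : ν (Set.range fun σ : Λ → E => juxtapose Λ σ ω)ᶜ = 0)
    (h : ∀ σ : Λ → E, μ {juxtapose Λ σ ω} = ν {juxtapose Λ σ ω}) : μ = ν := by
  ext A -
  rw [← measure_inter_conull hμ, ← measure_inter_conull (μ := ν) hν]
  have hfin := (Set.finite_range fun σ : Λ → E => juxtapose Λ σ ω).inter_of_right A
  rw [← hfin.coe_toFinset, ← sum_measure_singleton, ← sum_measure_singleton]
  refine Finset.sum_congr rfl fun x hx => ?_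
  obtain ⟨-, σ, rfl⟩ := hfin.mem_toFinset.1 hx
  exact h σ

lemma _root_.GibbsRep.spinMeasure_singleton [Finite E] [MeasurableSingletonClass E] (x : E) :
    spinMeasure E {x} = (Nat.card E : ℝ≥0∞)⁻¹ := by
  have := Fintype.ofFinite E
  rw [spinMeasure, uniformOn_univ, Measure.count_singleton, Nat.card_eq_fintype_card, one_div]

instance _root_.GibbsRep.isProbabilityMeasure_spinMeasure [Finite E] [Nonempty E]
    [MeasurableSingletonClass E] : IsProbabilityMeasure (spinMeasure E) :=
  isProbabilityMeasure_uniformOn Set.finite_univ Set.univ_nonempty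

section

variable [Finite E] [DiscreteMeasurableSpace E]

lemma _root_.GibbsRep.measurableEmbedding_juxtapose (Λ : Finset S) (ω : Config S E) :
    MeasurableEmbedding fun σ : Λ → E => juxtapose Λ σ ω :=
  ⟨juxtapose_injective Λ ω, Measurable.of_discrete, fun _ _ =>
    (Set.toFinite _).measurableSet⟩

lemma sum_weight_juxtapose (Λ : Finset S) (ω : Config S E) [Fintype (Λ → E)] :
    ∑ σ : Λ → E, γ.weight Λ (juxtapose Λ σ ω) = 1 := by
  classical
  have := γ.isMarkov Λ
  have h1 : ∀ σ : Λ → E, γ.weight Λ (juxtapose Λ σ ω)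
      = (γ.kernel Λ ω).real {juxtapose Λ σ ω} := by
    intro σ
    rw [weight, γ.kernel_congr (η := ω) fun i hi => juxtapose_of_notMem σ ω hi]
  simp only [h1]
  rw [← Finset.sum_image (s := Finset.univ) (g := fun σ : Λ → E => juxtapose Λ σ ω)
    (f := fun x => (γ.kernel Λ ω).real {x}) (juxtapose_injective Λ ω).injOn,
    sum_measureReal_singleton, Finset.coe_image, Finset.coe_univ, Set.image_univ]
  have h2 : Set.range (fun σ : Λ → E => juxtapose Λ σ ω) = {η | ∀ i ∉ Λ, η i = ω i} :=
    Set.ext fun η => mem_range_juxtapose_iff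
  have h3 := γ.kernel_inter_agree (Λ := Λ) ω Set.univ
  rw [Set.univ_inter, measure_univ] at h3
  rw [h2, measureReal_def, h3, ENNReal.toReal_one]

variable [Nonempty E]

/-- If the energy differences of a potential are the logarithmic ratios of the weights of a
specification, then the Gibbs distributions of the potential are its kernels. -/
lemma kernel_eq_gibbsDistribution (hpos : ∀ Λ ω, 0 < γ.weight Λ ω) (Ψ : Potential S E)
    (Λ : Finset S) (ω : Config S E)
    (h : ∀ η, (∀ i ∉ Λ, η i = ω i) → Ψ.hamiltonian Λ η - Ψ.hamiltonian Λ ω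
      = Real.log (γ.weight Λ ω) - Real.log (γ.weight Λ η)) :
    γ.kernel Λ ω = Ψ.gibbsDistribution Λ ω := by
  classical
  have := Fintype.ofFinite E
  have := γ.isMarkov Λ
  have hJ := measurableEmbedding_juxtapose (E := E) Λ ω
  set w : ℝ := ((Nat.card E : ℝ)⁻¹) ^ Λ.card with hw
  have hcard : (0 : ℝ) < Nat.card E := Nat.cast_pos.2 Nat.card_pos
  have hw0 : 0 < w := by positivity
  have hpi : ∀ σ : Λ → E, (Measure.pi fun _ : Λ => spinMeasure E) {σ} = ENNReal.ofReal w := by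
    intro σ
    rw [Measure.pi_singleton, hw, ENNReal.ofReal_pow (by positivity),
      ENNReal.ofReal_inv_of_pos hcard, ENNReal.ofReal_natCast]
    simp [spinMeasure_singleton]
  -- By `h`, the ratio of Boltzmann factor to weight is constant on the configurations agreeing with
  -- `ω` off `Λ`; `K` is that constant.
  set K : ℝ := Real.exp (-Ψ.hamiltonian Λ ω) / γ.weight Λ ω with hK
  have hK0 : 0 < K := div_pos (Real.exp_pos _) (hpos _ _)
  have hexp : ∀ σ : Λ → E, Real.exp (-Ψ.hamiltonian Λ (juxtapose Λ σ ω))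
      = K * γ.weight Λ (juxtapose Λ σ ω) := by
    intro σ
    have h1 := h (juxtapose Λ σ ω) fun i hi => juxtapose_of_notMem σ ω hi
    have h2 : -Ψ.hamiltonian Λ (juxtapose Λ σ ω) = -Ψ.hamiltonian Λ ω
        + (Real.log (γ.weight Λ (juxtapose Λ σ ω)) - Real.log (γ.weight Λ ω)) := by
      linarith
    rw [h2, Real.exp_add, Real.exp_sub, Real.exp_log (hpos _ _), Real.exp_log (hpos _ _), hK]
    ring
  have hZ : Ψ.partitionFunction Λ ω = w * K := by
    rw [Potential.partitionFunction, boundaryMeasure, hJ.integral_map,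
      integral_fintype (Integrable.of_finite)]
    simp only [hexp, measureReal_def, hpi, ENNReal.toReal_ofReal hw0.le, smul_eq_mul]
    rw [← Finset.mul_sum, ← Finset.mul_sum, γ.sum_weight_juxtapose, mul_one]
  refine measure_eq_of_range_juxtapose (Λ := Λ) (ω := ω) ?_ ?_ fun σ => ?_
  · have h2 : Set.range (fun σ : Λ → E => juxtapose Λ σ ω) = {η | ∀ i ∉ Λ, η i = ω i} :=
      Set.ext fun η => mem_range_juxtapose_iff
    rw [h2]
    exact γ.kernel_compl_agree ω
  · refine withDensity_absolutelyContinuous _ _ ?_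
    rw [boundaryMeasure, hJ.map_apply]
    simp
  · rw [Potential.gibbsDistribution, withDensity_apply _ (measurableSet_singleton _),
      lintegral_singleton, hexp, hZ, boundaryMeasure, hJ.map_apply,
      ← Set.image_singleton (f := fun σ : Λ → E => juxtapose Λ σ ω),
      Set.preimage_image_eq _ hJ.injective, hpi, ← ENNReal.ofReal_mul', Set.image_singleton]
    · have : K * γ.weight Λ (juxtapose Λ σ ω) / (w * K) * w
          = γ.weight Λ (juxtapose Λ σ ω) := by
        field_simp
      rw [this, weight, γ.kernel_congr (η := ω) fun i hi => juxtapose_of_notMem σ ω hi,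
        ofReal_measureReal]
    · exact hw0.le

/-! ### Quasilocality and positivity of the weights -/

lemma _root_.GibbsRep.measurableSet_cylinder_sigmaAlg (Λ : Finset S) (τ : Λ → E) :
    MeasurableSet[sigmaAlg E (Λ : Set S)] {σ : Config S E | ∀ i : Λ, σ i = τ i} := by
  have := measurableSet_agree (Λ : Set S) (juxtapose Λ τ fun _ => Classical.arbitrary E)
  convert this using 1
  ext σ
  simp only [Set.mem_ofPred_eq, Subtype.forall]
  exact forall₂_congr fun i hi => by rw [juxtapose_of_mem _ _ hi]

lemma _root_.GibbsRep.aprioriMeasure_cylinder_pos (Λ : Finset S) (τ : Λ → E) :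
    0 < (aprioriMeasure S E).real {σ : Config S E | ∀ i : Λ, σ i = τ i} := by
  have hset : {σ : Config S E | ∀ i : Λ, σ i = τ i} = cylinder (α := fun _ : S => E) Λ {τ} := by
    ext σ
    simp [funext_iff]
  have : IsProbabilityMeasure (aprioriMeasure S E) := by
    unfold aprioriMeasure; infer_instance
  refine (measureReal_nonneg).lt_of_ne' ?_
  rw [measureReal_ne_zero_iff, hset, aprioriMeasure,
    Measure.infinitePi_cylinder _ (measurableSet_singleton _), Measure.pi_singleton,
    Finset.prod_ne_zero_iff]
  intro i _
  rw [spinMeasure_singleton]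
  simp

lemma IsQuasilocal.hasVanishingOscillation_real {γ : Specification S E} (hγ : γ.IsQuasilocal)
    (Λ : Finset S) (τ : Λ → E) : HasVanishingOscillation fun ω =>
      (γ.kernel Λ ω).real {σ | ∀ i : Λ, σ i = τ i} := by
  have hm := measurableSet_cylinder_sigmaAlg Λ τ
  have := hγ Λ ({σ : Config S E | ∀ i : Λ, σ i = τ i}.indicator 1)
    ⟨Λ, Measurable.indicator (m := sigmaAlg E (Λ : Set S))
      (@measurable_const ℝ (Config S E) _ (sigmaAlg E (Λ : Set S)) 1) hm⟩
  simp only [integral_indicator_one (cylinderEvents_le_pi _ hm)] at this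
  exact this.hasVanishingOscillation

lemma IsQuasilocal.hasVanishingOscillation_weight {γ : Specification S E}
    (hγ : γ.IsQuasilocal) (Λ : Finset S) : HasVanishingOscillation (γ.weight Λ) := by
  have := HasVanishingOscillation.select fun τ => hγ.hasVanishingOscillation_real Λ τ
  refine fun ε hε => (this ε hε).imp fun M hM ω η h => ?_
  rw [← real_cylinder_eq_weight, ← real_cylinder_eq_weight]
  exact hM ω η h

/-- A uniformly non-null measure charges every cylinder. -/
lemma _root_.GibbsRep.IsDLR.measure_cylinder_pos {γ : Specification S E}
    {μ : Measure (Config S E)} (hγ : γ.IsUniformlyNonNull) (hμ : IsDLR γ μ) (Λ : Finset S)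
    (τ : Λ → E) : 0 < μ.real {σ : Config S E | ∀ i : Λ, σ i = τ i} := by
  obtain ⟨α, β, hα, -, h⟩ := hγ Λ
  obtain ⟨hprob, hcond⟩ := hμ
  have hm := measurableSet_cylinder_sigmaAlg Λ τ
  have hm' : MeasurableSet {σ : Config S E | ∀ i : Λ, σ i = τ i} := cylinderEvents_le_pi _ hm
  have hc := hcond Λ _ hm'
  have hle : sigmaAlg E ((Λ : Set S)ᶜ) ≤ MeasurableSpace.pi := cylinderEvents_le_pi
  have hint := integral_condExp (μ := μ) hle
    (f := {σ : Config S E | ∀ i : Λ, σ i = τ i}.indicator fun _ => (1 : ℝ))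
  rw [integral_congr_ae hc, integral_indicator_const _ hm', smul_eq_mul, mul_one] at hint
  rw [← hint]
  have hmono := integral_mono (μ := μ) (integrable_const _) (integrable_condExp.congr hc)
    fun ω => (h ω _ hm).1
  rw [integral_const, probReal_univ, one_smul] at hmono
  exact (mul_pos hα (aprioriMeasure_cylinder_pos Λ τ)).trans_le hmono

/-- The weights of a quasilocal specification for a uniformly non-null measure are bounded away
from zero. -/
lemma IsQuasilocal.exists_pos_le_weight {γ : Specification S E} {μ : Measure (Config S E)}
    (hγ : γ.IsQuasilocal) (hμ : IsDLR γ μ) (hn : IsUniformlyNonNullMeasure μ) (Λ : Finset S) :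
    ∃ c : ℝ, 0 < c ∧ ∀ ω, c ≤ γ.weight Λ ω := by
  obtain ⟨γ', hγ', hμ'⟩ := hn
  obtain ⟨α, β, hα, -, h⟩ := hγ' Λ
  obtain ⟨τ₀, hτ₀⟩ := Finite.exists_min fun τ : Λ → E =>
    (aprioriMeasure S E).real {σ : Config S E | ∀ i : Λ, σ i = τ i}
  refine ⟨_, mul_pos hα (aprioriMeasure_cylinder_pos Λ τ₀), fun ω => ?_⟩
  rw [← real_cylinder_eq_weight]
  let τ : Λ → E := fun i => ω i
  have hm := measurableSet_cylinder_sigmaAlg Λ τ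
  have hm' : MeasurableSet {σ : Config S E | ∀ i : Λ, σ i = τ i} := cylinderEvents_le_pi _ hm
  -- The bound holds everywhere for `γ'`, but passes to `γ` only almost everywhere.
  have hae : ∀ᵐ η ∂μ, α * (aprioriMeasure S E).real {σ : Config S E | ∀ i : Λ, σ i = τ₀ i}
      ≤ (γ.kernel Λ η).real {σ | ∀ i : Λ, σ i = τ i} := by
    filter_upwards [hμ.2 Λ _ hm', hμ'.2 Λ _ hm'] with η h1 h2
    rw [← h1, h2]
    exact (mul_le_mul_of_nonneg_left (hτ₀ τ) hα.le).trans (h η _ hm).1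
  -- Any cylinder around `ω` has positive mass, hence contains a point `η` where the bound holds;
  -- quasilocality moves it to `ω` with error `ε`.
  refine le_of_forall_pos_le_add fun ε hε => ?_
  obtain ⟨M, hM⟩ := hγ.hasVanishingOscillation_real Λ τ ε hε
  have hpos := hμ'.measure_cylinder_pos hγ' M fun i => ω i
  have hfreq : ∃ᵐ η ∂μ, η ∈ {σ : Config S E | ∀ i : M, σ i = ω i} := by
    rw [frequently_ae_mem_iff]
    intro h0
    rw [measureReal_def, h0, ENNReal.toReal_zero] at hpos
    exact hpos.false
  obtain ⟨η, hη, hle⟩ := (hfreq.and_eventually hae).exists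
  have := le_of_abs_le (hM η ω fun i hi => hη ⟨i, hi⟩)
  linarith

end

end Specification

end Spec

/-! ### The representation theorem -/

section Resummation

variable {S E : Type*} [Countable S] [Finite E] [Nonempty E] [MeasurableSpace E]
  [DiscreteMeasurableSpace E]

/-- The relative energies of a specification with strictly positive quasilocal weights are those
of a uniformly absolutely convergent potential. -/
lemma Specification.exists_potential_hamiltonian_sub (γ : Specification S E)
    (hosc : ∀ Λ, HasVanishingOscillation (γ.weight Λ))
    (hpos : ∀ Λ, ∃ c : ℝ, 0 < c ∧ ∀ ω, c ≤ γ.weight Λ ω) :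
    ∃ Ψ : Potential S E, Ψ.IsUAC ∧ ∀ (Λ : Finset S) (ω η : Config S E),
      (∀ i ∉ Λ, η i = ω i) → Ψ.hamiltonian Λ η - Ψ.hamiltonian Λ ω
        = Real.log (γ.weight Λ ω) - Real.log (γ.weight Λ η) := by
  classical
  have hpos' : ∀ Λ ω, 0 < γ.weight Λ ω := fun Λ ω => by
    obtain ⟨c, hc, h⟩ := hpos Λ
    exact hc.trans_le (h ω)
  obtain ⟨e, he⟩ := exists_injective_nat S
  let a : Config S E := fun _ => Classical.arbitrary E
  have hfin : ∀ k, {s | e s < k}.Finite := fun k =>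
    (Set.finite_Iio k).preimage he.injOn
  let V : ℕ → Finset S := fun k => (hfin k).toFinset
  have hV : ∀ k s, s ∈ V k ↔ e s < k := fun k s => by simp [V]
  have hVmono : ∀ {k l}, k ≤ l → V k ⊆ V l := fun {k l} h s hs =>
    (hV l s).2 (((hV k s).1 hs).trans_le h)
  -- If no site has number `k`, then `V (k + 1) = V k` and `D k` vanishes, so `e` need not be
  -- surjective.
  let D : ℕ → Config S E → ℝ := fun k ω =>
    Real.log (γ.weight (V (k + 1)) (glue (V (k + 1)) a ω))
      - Real.log (γ.weight (V (k + 1)) (glue (V k) a ω))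
  have hDosc : ∀ k, HasVanishingOscillation (D k) := by
    intro k
    obtain ⟨c, hc, h⟩ := hpos (V (k + 1))
    have hlog := (hosc (V (k + 1))).log hc h
    exact (hlog.comp_glue _ a).sub (hlog.comp_glue _ a)
  have hDglue : ∀ k ω, D k (glue (V k) a ω) = D k ω := fun k ω => by
    simp only [D, glue_self_glue, glue_glue_of_subset (hVmono k.le_succ)]
  choose B ψ c hdep hdisj hψc hcs hsum using
    fun k => (hDosc k).exists_hasSum (V k) a (hDglue k)
  have hlt : ∀ {k n s}, s ∈ B k n → k ≤ e s := fun {k n s} hs => by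
    by_contra! h
    exact Finset.disjoint_left.1 (hdisj k n) hs ((hV k s).2 h)
  have hc0 : ∀ k n, 0 ≤ c k n := fun k n => (abs_nonneg _).trans (hψc k n a)
  obtain ⟨Ψ, hUAC, hΨ⟩ := exists_potential_isUAC (ι := ℕ × ℕ) (B := fun p => B p.1 p.2)
    (ψ := fun p => ψ p.1 p.2) (c := fun p => c p.1 p.2) (fun p => hdep p.1 p.2)
    (fun p => hψc p.1 p.2) (by
      intro j
      rw [summable_prod_of_nonneg fun p => Set.indicator_nonneg (fun p _ => hc0 p.1 p.2) p]
      refine ⟨fun k => Summable.of_nonneg_of_le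
        (fun n => Set.indicator_nonneg (fun p _ => hc0 p.1 p.2) _)
        (fun n => Set.indicator_le_self' (fun p _ => hc0 p.1 p.2) _) (hcs k), ?_⟩
      -- Supports in row `k` avoid `V k`, so only rows `k ≤ e j` see the site `j`.
      refine summable_of_ne_finset_zero (s := Finset.range (e j + 1)) fun k hk => ?_
      rw [← tsum_zero (β := ℕ)]
      refine tsum_congr fun n => Set.indicator_of_notMem (fun h => hk ?_) _
      exact Finset.mem_range.2 (Nat.lt_succ_of_le (hlt h)))
  refine ⟨Ψ, hUAC, fun Λ ω η hωη => ?_⟩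
  obtain ⟨N, hN⟩ : ∃ N, Λ ⊆ V N := by
    refine ⟨Λ.sup e + 1, fun s hs => (hV _ s).2 (Nat.lt_succ_of_le (Finset.le_sup hs))⟩
  -- Row by row, terms not meeting `Λ` take equal values at `η` and `ω`, so a row `k < N` sums to
  -- the full difference of `D k`; rows `k ≥ N` never meet `Λ`.
  have hdiff := ((hΨ Λ η).sub (hΨ Λ ω)).prod_fiberwise
    (g := fun k => if k ∈ Finset.range N then D k η - D k ω else 0) (by
      intro k
      by_cases hk : k ∈ Finset.range N
      · rw [if_pos hk]
        convert (hsum k η).sub (hsum k ω) using 2 with n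
        by_cases h : (k, n) ∈ {p : ℕ × ℕ | ∃ i ∈ B p.1 p.2, i ∈ Λ}
        · rw [Set.indicator_of_mem h, Set.indicator_of_mem h]
        · rw [Set.indicator_of_notMem h, Set.indicator_of_notMem h,
            hdep k n fun i hi => hωη i fun hi' => h ⟨i, hi, hi'⟩, sub_self, sub_self]
      · rw [if_neg hk]
        convert hasSum_zero using 2 with n
        have h : (k, n) ∉ {p : ℕ × ℕ | ∃ i ∈ B p.1 p.2, i ∈ Λ} := by
          rintro ⟨i, hi, hiΛ⟩
          exact hk (Finset.mem_range.2 ((hlt hi).trans_lt ((hV N i).1 (hN hiΛ))))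
        rw [Set.indicator_of_notMem h, Set.indicator_of_notMem h, sub_self])
  have htel := hdiff.unique (hasSum_sum_of_ne_finset_zero (s := Finset.range N)
    fun k hk => if_neg hk)
  rw [htel, Finset.sum_congr rfl fun k hk => if_pos hk, Finset.sum_sub_distrib]
  have hD : ∀ ω, ∑ k ∈ Finset.range N, D k ω
      = Real.log (γ.weight (V N) (glue (V N) a ω)) - Real.log (γ.weight (V N) ω) := by
    intro ω
    have h0 : glue (V 0) a ω = ω := funext fun i => glue_of_notMem _ _ (by simp [hV])
    -- Volume independence replaces every `V (k + 1)` by the common volume `V N`, after which the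
    -- sum telescopes.
    have hDN : ∀ k ∈ Finset.range N, D k ω = Real.log (γ.weight (V N) (glue (V (k + 1)) a ω))
        - Real.log (γ.weight (V N) (glue (V k) a ω)) := by
      intro k hk
      refine (γ.log_weight_sub_log_weight hpos' (hVmono (Finset.mem_range.1 hk)) ?_).symm
      intro i hi
      rw [glue_of_notMem _ _ hi, glue_of_notMem _ _ fun h => hi (hVmono k.le_succ h)]
    rw [Finset.sum_congr rfl hDN,
      Finset.sum_range_sub fun k => Real.log (γ.weight (V N) (glue (V k) a ω)), h0]
  have hglue : glue (V N) a η = glue (V N) a ω := by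
    ext i
    by_cases hi : i ∈ V N
    · rw [glue_of_mem _ _ hi, glue_of_mem _ _ hi]
    · rw [glue_of_notMem _ _ hi, glue_of_notMem _ _ hi, hωη i fun h => hi (hN h)]
  rw [hD, hD, hglue, ← γ.log_weight_sub_log_weight hpos' hN fun i hi => (hωη i hi).symm]
  ring

end Resummation

end GibbsRep

theorem mainTheorem2 {S E : Type*} [Countable S] [Finite E] [Nonempty E] [MeasurableSpace E]
    [DiscreteMeasurableSpace E] (μ : Measure (S → E)) [IsProbabilityMeasure μ]
    (hq : GibbsRep.IsQuasilocalMeasure μ) (hn : GibbsRep.IsUniformlyNonNullMeasure μ) :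
    ∃ Ψ : GibbsRep.Potential S E, Ψ.IsUAC ∧ Ψ.IsGibbsMeasure μ := by
  obtain ⟨γ, hγ, hμ⟩ := hq
  have hpos := hγ.exists_pos_le_weight hμ hn
  obtain ⟨Ψ, hUAC, hΨ⟩ :=
    γ.exists_potential_hamiltonian_sub hγ.hasVanishingOscillation_weight hpos
  refine ⟨Ψ, hUAC, γ, fun Λ ω => ?_, hμ⟩
  refine γ.kernel_eq_gibbsDistribution (fun Λ ω => ?_) Ψ Λ ω (hΨ Λ ω)
  obtain ⟨c, hc, h⟩ := hpos Λ
  exact hc.trans_le (h ω)
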